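/- Let $G=(V,E)$ be a finite connected simple graph with a start vertex $v_s\in V$, vertex weights $w_v\in\mathbb{N}_0$ ($v\in V$) and edge weights $w_e\in\mathbb{N}_0$ ($e\in E$). A \emph{schedule} for $k$ agents runs over finitely many time steps. All agents start at $v_s$ at time $0$, and in each time step every agent either stays at its vertex or moves along an edge to an adjacent vertex (so the agents may split into groups that move separately). The schedule is a \emph{deployment strategy} if (i) whenever agents move from $u$ to $v$ along an edge $e=\{u,v\}$ in a time step, at least $w_e$ agents move from $u$ to $v$ in that step; (ii) at the first visit of a vertex $v$ (i.e. at the first time at which some agent is located at $v$; for $v_s$ this is time $0$) exactly $w_v$ of the agents located at $v$ become \emph{settled} at $v$, and they stay there until the end; (iii) at the end all vertices of $G$ have been visited. In the \emph{return variant} it is required in addition that at the end there is a set $M$ of agents located at $v_s$ such that every vertex of $G$ has been visited by a member of $M$; in the \emph{no-return variant} nothing more is required. A strategy \emph{moves in a single group} if at every time all non-settled agents are located at the same vertex, and in the following time step all of them stay there or all of them move along the same edge (some of them may become settled on arrival). Then, in the no-return variant as well as in the return variant, there is a minimal number $k$ of agents for which a deployment strategy exists, and for this minimal number $k$ there is a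 deployment strategy for $k$ agents that moves in a single group. -/

import Mathlib

/-- A movement plan of `k` agents on the graph `G` during the time steps `0, 1, ..., horizon`.
All agents start in `s`; in one time step every agent stays where it is or moves along one edge.
`guards v` is the set of agents that are settled at `v` (from the first visit of `v` on).
The values `pos t a` with `horizon < t` play no role. -/
structure Schedule {V : Type*} (G : SimpleGraph V) (s : V) (k : ℕ) where
  /-- number of time steps -/
  horizon : ℕ
  /-- `pos t a` is the position of agent `a` at time `t` -/
  pos : ℕ → Fin k → V
  /-- the agents that get settled at a vertex -/
  guards : V → Finset (Fin k)
  start : ∀ a, pos 0 a = s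
  step : ∀ t < horizon, ∀ a, pos (t + 1) a = pos t a ∨ G.Adj (pos t a) (pos (t + 1) a)

namespace Schedule

variable {V : Type*} {G : SimpleGraph V} {s : V} {k : ℕ}

/-- Some agent has been at `v` at some time `≤ t`. -/
def VisitedBy (σ : Schedule G s k) (t : ℕ) (v : V) : Prop :=
  ∃ t' ≤ t, ∃ a, σ.pos t' a = v

/-- Agent `a` is settled at time `t`. -/
def Settled (σ : Schedule G s k) (t : ℕ) (a : Fin k) : Prop :=
  ∃ v, σ.VisitedBy t v ∧ a ∈ σ.guards v

/-- Validity for vertex weights `wV` and edge weights `wE`. -/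
structure Valid [DecidableEq V] (σ : Schedule G s k) (wV : V → ℕ) (wE : Sym2 V → ℕ) : Prop where
  /-- an edge is only traversed by a force of at least `wE e` agents moving along it together -/
  edge : ∀ t < σ.horizon, ∀ a, σ.pos (t + 1) a ≠ σ.pos t a →
    wE s(σ.pos t a, σ.pos (t + 1) a) ≤
      (Finset.univ.filter fun b : Fin k =>
        σ.pos t b = σ.pos t a ∧ σ.pos (t + 1) b = σ.pos (t + 1) a).card
  /-- exactly `wV v` agents are settled at `v` -/
  guards_card : ∀ v, (σ.guards v).card = wV v
  /-- from the first visit of `v` on, the agents settled at `v` stand at `v` -/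
  guards_stay : ∀ t ≤ σ.horizon, ∀ v, σ.VisitedBy t v → ∀ a ∈ σ.guards v, σ.pos t a = v
  /-- in the end all vertices have been visited (and hence are covered) -/
  all_visited : ∀ v, σ.VisitedBy σ.horizon v

/-- In the end a set `M` of agents is back at `s`, and together the members of `M` have visited
every vertex. -/
def Returns (σ : Schedule G s k) : Prop :=
  ∃ M : Finset (Fin k), (∀ a ∈ M, σ.pos σ.horizon a = s) ∧
    ∀ v, ∃ a ∈ M, ∃ t ≤ σ.horizon, σ.pos t a = v

/-- The non-settled agents form a single group: at every time they are all at the same vertex, and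
in the next step they all make the same move (some may be settled on arrival). -/
def SingleGroup (σ : Schedule G s k) : Prop :=
  (∀ t ≤ σ.horizon, ∀ a b, ¬ σ.Settled t a → ¬ σ.Settled t b → σ.pos t a = σ.pos t b) ∧
  (∀ t < σ.horizon, ∀ a b, ¬ σ.Settled t a → ¬ σ.Settled t b → σ.pos (t + 1) a = σ.pos (t + 1) b)

end Schedule

/-- The two variants of the deployment problem. -/
inductive DeploymentVariant where
  /-- it suffices to fill the vertices -/
  | noReturn
  /-- agents finally have to return to the start vertex and report the success -/
  | withReturn

/-- `σ` is a deployment strategy (solves the strategic deployment problem) in the given variant. -/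
def Schedule.IsDeployment {V : Type*} [DecidableEq V] {G : SimpleGraph V} {s : V} {k : ℕ}
    (σ : Schedule G s k) (wV : V → ℕ) (wE : Sym2 V → ℕ) : DeploymentVariant → Prop
  | .noReturn => σ.Valid wV wE
  | .withReturn => σ.Valid wV wE ∧ σ.Returns

/-- `k` is the minimal number of agents required for the strategic deployment problem. -/
def IsMinAgents {V : Type*} [DecidableEq V] (G : SimpleGraph V) (s : V)
    (wV : V → ℕ) (wE : Sym2 V → ℕ) (var : DeploymentVariant) (k : ℕ) : Prop :=
  IsLeast {m : ℕ | ∃ σ : Schedule G s m, σ.IsDeployment wV wE var} k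

/-! The core of the argument is an invariant of arbitrary, split-up schedules: at every time the
agents can be placed on a line of entries, each carrying a vertex, so that one group sweeping the
line from left to right could have produced the situation. With `load e d` counting the agents to
the right of `d`, vertices of later entries can be reached from `x d` over edges of weight at most
this load, through vertices not to the right of the target. The history of an agent occurs to its
left or at its own entry, and settled guards of a vertex stand no later than its first occurrence.

To preserve the invariant, a time step is split by destination: for one vertex `v` at a time, the
set `Y` of all agents entering `v` is moved (`IsArrangement.move`). If `Y` is at least as large as
the force it leaves behind, it becomes a new last entry and may serve as the rest of the group.
Otherwise `Y` is inserted in the middle, and the larger remaining force makes the detour to `v` and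
back. The bound `free_le` keeps this dichotomy working.

At the end the line is turned into a tour (`IsArrangement.groupTour`). For a set `A` of agents that
together saw everything, the tour may stop at the rightmost member of `A`, hence where that member
ends. Taking all agents gives the no-return variant; taking the returning set `M` gives a tour
ending at `s`. `GroupTour.exists_schedule` turns tours into schedules with the same number of
agents, so a minimal strategy may be replaced by a single-group one. -/

/-- `u` and `v` are joined by a path of `G` inside `T` whose edges have weight at most `c`. -/
def Linked {V : Type*} (G : SimpleGraph V) (wE : Sym2 V → ℕ) (c : ℕ) (T : Set V) (u v : V) : Prop :=
  Relation.ReflTransGen (fun a b => G.Adj a b ∧ a ∈ T ∧ b ∈ T ∧ wE s(a, b) ≤ c) u v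

namespace Linked

variable {V : Type*} {G : SimpleGraph V} {wE : Sym2 V → ℕ} {c c' : ℕ} {T T' : Set V} {u v w : V}

theorem refl : Linked G wE c T u u := Relation.ReflTransGen.refl

theorem trans (h : Linked G wE c T u v) (h' : Linked G wE c T v w) : Linked G wE c T u w :=
  Relation.ReflTransGen.trans h h'

theorem symm (h : Linked G wE c T u v) : Linked G wE c T v u := by
  unfold Linked at *
  induction h with
  | refl => exact .refl
  | tail _ hbc ih =>
    refine .head ⟨hbc.1.symm, hbc.2.2.1, hbc.2.1, ?_⟩ ih
    rw [Sym2.eq_swap]; exact hbc.2.2.2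

theorem mono (h : Linked G wE c T u v) (hc : c ≤ c') (hT : T ⊆ T') : Linked G wE c' T' u v :=
  Relation.ReflTransGen.mono (fun _ _ h => ⟨h.1, hT h.2.1, hT h.2.2.1, h.2.2.2.trans hc⟩) _ _ h

theorem of_eq_or_adj (h : u = v ∨ (G.Adj u v ∧ wE s(u, v) ≤ c)) (hu : u ∈ T) (hv : v ∈ T) :
    Linked G wE c T u v := by
  rcases h with rfl | h
  · exact refl
  · exact Relation.ReflTransGen.single ⟨h.1, hu, hv, h.2⟩

end Linked

/-! ### Linear arrangements and their behaviour under moves -/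

/-- Agent `a` is settled: it guards a vertex that some agent has visited. -/
def GuardsVisited {V α : Type*} (guards : V → Finset α) (hist : α → V → Prop) (a : α) : Prop :=
  ∃ v, (∃ b, hist b v) ∧ a ∈ guards v

/-- The number of agents whose entry lies beyond `d`. -/
def load {α : Type*} [Fintype α] (e : α → ℚ) (d : ℚ) : ℕ :=
  (Finset.univ.filter fun a => d < e a).card

open Classical in
/-- A linear arrangement of the agents: `D` is a finite set of entries, `x d` is the vertex of the
entry `d`, and the agent `a` belongs to the entry `e a`, whose vertex is its position. A single
group can visit the vertices of the entries in increasing order, where on leaving the entry `d` it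
still contains the agents beyond `d`. -/
structure IsArrangement {V α : Type*} [Fintype α] (G : SimpleGraph V) (s : V) (wE : Sym2 V → ℕ)
    (guards : V → Finset α) (pos : α → V) (hist : α → V → Prop)
    (D : Finset ℚ) (x : ℚ → V) (e : α → ℚ) : Prop where
  zero_mem : 0 ∈ D
  nonneg : ∀ d ∈ D, 0 ≤ d
  x_zero : x 0 = s
  e_mem : ∀ a, e a ∈ D
  x_e : ∀ a, x (e a) = pos a
  exists_le : ∀ d ∈ D, ∃ a, d ≤ e a
  visited : ∀ d ∈ D, ∃ b, hist b (x d)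
  linked : ∀ d ∈ D, ∀ d' ∈ D, d < d' →
    Linked G wE (load e d) (x '' {p | p ∈ D ∧ p ≤ d'}) (x d) (x d')
  free_le : ∀ d ∈ D, ∀ d' ∈ D, d < d' →
    (Finset.univ.filter fun a => e a = d ∧ ¬ GuardsVisited guards hist a).card ≤ load e d
  hist_le : ∀ a z, hist a z → ∃ d ∈ D, d ≤ e a ∧ x d = z
  guard_le : ∀ v, (∃ b, hist b v) → ∀ a ∈ guards v, ∀ d ∈ D, x d = v → e a ≤ d

namespace IsArrangement

variable {V α : Type*} [Fintype α] {G : SimpleGraph V} {s : V} {wE : Sym2 V → ℕ}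
  {guards : V → Finset α} {pos : α → V} {hist : α → V → Prop}
  {D : Finset ℚ} {x : ℚ → V} {e : α → ℚ}

/-- The pivot is the last entry of `Y`, or an entry of an already visited `v` if that lies further
right. Thus moving `Y` beyond it moves agents only to the right and keeps the settled guards of `v`
behind them. -/
theorem exists_pivot (h : IsArrangement G s wE guards pos hist D x e) {Y : Finset α} {v : V}
    (hY : Y.Nonempty) (hadj : ∀ a ∈ Y, G.Adj (pos a) v ∧ wE s(pos a, v) ≤ Y.card) :
    ∃ j ∈ D, (∀ a ∈ Y, e a ≤ j) ∧ ((∃ b, hist b v) → ∃ d ∈ D, d ≤ j ∧ x d = v) ∧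
      (x j = v ∨ (G.Adj (x j) v ∧ wE s(x j, v) ≤ Y.card)) := by
  obtain ⟨a, haY, ha⟩ := Y.exists_max_image e hY
  have hxa := hadj a haY
  rw [← h.x_e] at hxa
  by_cases hv : ∃ b, hist b v
  · obtain ⟨b, hb⟩ := hv
    obtain ⟨d, hd, -, hxd⟩ := h.hist_le b v hb
    rcases le_total d (e a) with hda | hda
    · exact ⟨e a, h.e_mem a, ha, fun _ => ⟨d, hd, hda, hxd⟩, .inr hxa⟩
    · exact ⟨d, hd, fun c hc => (ha c hc).trans hda, fun _ => ⟨d, hd, le_rfl, hxd⟩, .inl hxd⟩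
  · exact ⟨e a, h.e_mem a, ha, fun h' => absurd h' hv, .inr hxa⟩

theorem load_mono {e' : α → ℚ} (h : ∀ a, e a ≤ e' a) (d : ℚ) : load e d ≤ load e' d :=
  Finset.card_le_card fun a ha => by
    simp only [Finset.mem_filter, Finset.mem_univ, true_and] at ha ⊢
    exact ha.trans_le (h a)

theorem load_anti {d d' : ℚ} (h : d ≤ d') : load e d' ≤ load e d :=
  Finset.card_le_card fun a ha => by
    simp only [Finset.mem_filter, Finset.mem_univ, true_and] at ha ⊢
    exact h.trans_lt ha

theorem card_le_load {Y : Finset α} {d : ℚ} (h : ∀ a ∈ Y, d < e a) : Y.card ≤ load e d :=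
  Finset.card_le_card fun a ha => by simpa using h a ha

open Classical in
/-- The free agents of the entry `j` outside `Y`. -/
noncomputable def staying (guards : V → Finset α) (hist : α → V → Prop) (e : α → ℚ) (Y : Finset α) (j : ℚ) :
    Finset α :=
  Finset.univ.filter fun a => a ∉ Y ∧ e a = j ∧ ¬ GuardsVisited guards hist a

theorem mem_staying {Y : Finset α} {j : ℚ} {a : α} : a ∈ staying guards hist e Y j ↔
    a ∉ Y ∧ e a = j ∧ ¬ GuardsVisited guards hist a := by
  simp [staying]

open Classical in
-- Once `Y` stands at the far end, every old entry has load at least `Y.card`. Entries before `j`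
-- reach `v` through `j`; entries after `j` go back to `j` along links of weight at most `load e j`,
-- which `Y` can afford.
theorem append_entry (h : IsArrangement G s wE guards pos hist D x e) {Y : Finset α} {v : V} {j : ℚ}
    (hY : Y.Nonempty) (hfree : ∀ a ∈ Y, ¬ GuardsVisited guards hist a)
    (hguard : (¬ ∃ b, hist b v) → ∀ a ∈ guards v, a ∈ Y)
    (hj : j ∈ D) (hYj : ∀ a ∈ Y, e a ≤ j) (hvj : (∃ b, hist b v) → ∃ d ∈ D, d ≤ j ∧ x d = v)
    (hadj : x j = v ∨ (G.Adj (x j) v ∧ wE s(x j, v) ≤ Y.card))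
    (hlarge : (staying guards hist e Y j).card + load e j ≤ Y.card) :
    ∃ D' x' e', IsArrangement G s wE guards (fun a => if a ∈ Y then v else pos a)
      (fun a z => hist a z ∨ (a ∈ Y ∧ z = v)) D' x' e' := by
  obtain ⟨q, hq⟩ : ∃ q : ℚ, ∀ d ∈ D, d < q := by
    obtain ⟨q, hq⟩ := exists_gt (D.max' ⟨j, hj⟩)
    exact ⟨q, fun d hd => (D.le_max' d hd).trans_lt hq⟩
  have hqD : q ∉ D := fun h' => lt_irrefl _ (hq q h')
  set x' : ℚ → V := fun d => if d = q then v else x d with hx'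
  set e' : α → ℚ := fun a => if a ∈ Y then q else e a with he'
  have hx'D : ∀ d ∈ D, x' d = x d := fun d hd => by simp [hx', (hq d hd).ne]
  have hx'q : x' q = v := by simp [hx']
  have he'Y : ∀ a ∈ Y, e' a = q := fun a ha => by simp [he', ha]
  have he'n : ∀ a, a ∉ Y → e' a = e a := fun a ha => by simp [he', ha]
  have hle : ∀ a, e a ≤ e' a := fun a => by
    by_cases ha : a ∈ Y
    · rw [he'Y a ha]; exact (hq _ (h.e_mem a)).le
    · rw [he'n a ha]
  have hYl : ∀ d ∈ D, Y.card ≤ load e' d := fun d hd =>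
    card_le_load fun a ha => by rw [he'Y a ha]; exact hq d hd
  have hset : ∀ a, GuardsVisited guards hist a →
      GuardsVisited guards (fun a z => hist a z ∨ (a ∈ Y ∧ z = v)) a := by
    rintro a ⟨z, ⟨b, hb⟩, ha⟩; exact ⟨z, ⟨b, .inl hb⟩, ha⟩
  have hcond : ∀ {d d'}, d ∈ D → d' ∈ D → d < d' → ∀ t, d' ≤ t →
      Linked G wE (load e d) (x' '' {p | p ∈ insert q D ∧ p ≤ t}) (x d) (x d') := by
    intro d d' hd hd' hdd t ht
    refine (h.linked d hd d' hd' hdd).mono le_rfl ?_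
    rintro _ ⟨p, ⟨hp, hpd⟩, rfl⟩
    exact ⟨p, ⟨Finset.mem_insert_of_mem hp, hpd.trans ht⟩, hx'D p hp⟩
  have hmem : ∀ d ∈ D, x d ∈ x' '' {p | p ∈ insert q D ∧ p ≤ q} := fun d hd =>
    ⟨d, ⟨Finset.mem_insert_of_mem hd, (hq d hd).le⟩, hx'D d hd⟩
  have hmemv : v ∈ x' '' {p | p ∈ insert q D ∧ p ≤ q} :=
    ⟨q, ⟨Finset.mem_insert_self _ _, le_rfl⟩, hx'q⟩
  refine ⟨insert q D, x', e', ?_⟩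
  constructor
  · exact Finset.mem_insert_of_mem h.zero_mem
  · intro d hd
    rcases Finset.mem_insert.1 hd with rfl | hd
    · exact (hq 0 h.zero_mem).le
    · exact h.nonneg d hd
  · rw [hx'D 0 h.zero_mem, h.x_zero]
  · intro a
    by_cases ha : a ∈ Y
    · rw [he'Y a ha]; exact Finset.mem_insert_self _ _
    · rw [he'n a ha]; exact Finset.mem_insert_of_mem (h.e_mem a)
  · intro a
    by_cases ha : a ∈ Y
    · simp only [ha, if_true]; rw [he'Y a ha, hx'q]
    · simp only [ha, if_false]; rw [he'n a ha, hx'D _ (h.e_mem a), h.x_e]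
  · intro d hd
    rcases Finset.mem_insert.1 hd with rfl | hd
    · obtain ⟨a, ha⟩ := hY
      exact ⟨a, (he'Y a ha).ge⟩
    · obtain ⟨a, ha⟩ := h.exists_le d hd
      exact ⟨a, ha.trans (hle a)⟩
  · intro d hd
    rcases Finset.mem_insert.1 hd with rfl | hd
    · obtain ⟨a, ha⟩ := hY
      exact ⟨a, .inr ⟨ha, hx'q⟩⟩
    · obtain ⟨b, hb⟩ := h.visited d hd
      exact ⟨b, .inl (by rwa [hx'D d hd])⟩
  · intro d hd0 d' hd' hdd
    rcases Finset.mem_insert.1 hd0 with rfl | hd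
    · rcases Finset.mem_insert.1 hd' with rfl | hd'
      · exact absurd hdd (lt_irrefl _)
      · exact absurd (hq d' hd') hdd.not_gt
    rw [hx'D d hd]
    rcases Finset.mem_insert.1 hd' with rfl | hd'
    · rw [hx'q]
      refine Linked.trans (v := x j) ?_ ?_
      · rcases lt_trichotomy d j with hdj | rfl | hdj
        · exact (hcond hd hj hdj _ (hq j hj).le).mono (load_mono hle d) le_rfl
        · exact .refl
        · exact (hcond hj hd hdj _ (hq d hd).le).symm.mono
            (by have := hYl d hd; omega) le_rfl
      · exact (Linked.of_eq_or_adj hadj (hmem j hj) hmemv).mono (hYl d hd) le_rfl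
    · rw [hx'D d' hd']
      exact (hcond hd hd' hdd _ le_rfl).mono (load_mono hle d) le_rfl
  · intro d hd0 d' hd' hdd
    rcases Finset.mem_insert.1 hd0 with rfl | hd
    · rcases Finset.mem_insert.1 hd' with rfl | hd'
      · exact absurd hdd (lt_irrefl _)
      · exact absurd (hq d' hd') hdd.not_gt
    have hsub : ∀ a, e' a = d → a ∉ Y ∧ e a = d := fun a ha => by
      by_cases haY : a ∈ Y
      · rw [he'Y a haY] at ha; exact absurd (ha ▸ hd) hqD
      · exact ⟨haY, by rw [← he'n a haY, ha]⟩
    rcases lt_trichotomy d j with hdj | rfl | hdj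
    · refine le_trans (Finset.card_le_card ?_) ((h.free_le d hd j hj hdj).trans (load_mono hle d))
      intro a ha
      simp only [Finset.mem_filter, Finset.mem_univ, true_and] at ha ⊢
      exact ⟨(hsub a ha.1).2, fun h' => ha.2 (hset a h')⟩
    · refine le_trans (Finset.card_le_card ?_)
        (((Nat.le_add_right _ _).trans hlarge).trans (hYl d hd))
      intro a ha
      simp only [Finset.mem_filter, Finset.mem_univ, true_and] at ha
      exact mem_staying.2 ⟨(hsub a ha.1).1, (hsub a ha.1).2, fun h' => ha.2 (hset a h')⟩
    -- The agents at an entry beyond `j` are themselves counted by `load e j`. This also covers the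
    -- old last entry, for which `free_le` said nothing before.
    · refine le_trans (card_le_load (e := e) (d := j) ?_)
        (((Nat.le_add_left _ _).trans hlarge).trans (hYl d hd))
      intro a ha
      simp only [Finset.mem_filter, Finset.mem_univ, true_and] at ha
      rw [(hsub a ha.1).2]; exact hdj
  · rintro a z (hz | ⟨ha, rfl⟩)
    · obtain ⟨d, hd, hda, hxd⟩ := h.hist_le a z hz
      exact ⟨d, Finset.mem_insert_of_mem hd, hda.trans (hle a), by rw [hx'D d hd, hxd]⟩
    · exact ⟨q, Finset.mem_insert_self _ _, (he'Y a ha).ge, hx'q⟩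
  · intro z hz a ha d hd hxd
    rcases Finset.mem_insert.1 hd with rfl | hd
    · by_cases haY : a ∈ Y
      · exact (he'Y a haY).le
      · rw [he'n a haY]; exact (hq _ (h.e_mem a)).le
    · rw [hx'D d hd] at hxd
      have hz' : ∃ b, hist b z := hxd ▸ h.visited d hd
      rw [he'n a fun haY => hfree a haY ⟨z, hz', ha⟩]
      exact h.guard_le z hz' a ha d hd hxd

open Classical in
-- The entry `j` is continued by `q` at `v`, carrying `Y`, and then by `r` back at `x j`, carrying
-- the free agents that stay. Shifting the latter to `r` puts them beyond `q`, so the load there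
-- exceeds `Y.card` and pays for the way from `x j` to `v` and back.
theorem insert_entry (h : IsArrangement G s wE guards pos hist D x e) {Y : Finset α} {v : V} {j : ℚ}
    (hY : Y.Nonempty) (hfree : ∀ a ∈ Y, ¬ GuardsVisited guards hist a)
    (hguard : (¬ ∃ b, hist b v) → ∀ a ∈ guards v, a ∈ Y)
    (hj : j ∈ D) (hYj : ∀ a ∈ Y, e a ≤ j) (hvj : (∃ b, hist b v) → ∃ d ∈ D, d ≤ j ∧ x d = v)
    (hadj : x j = v ∨ (G.Adj (x j) v ∧ wE s(x j, v) ≤ Y.card))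
    (hsmall : Y.card < (staying guards hist e Y j).card + load e j) :
    ∃ D' x' e', IsArrangement G s wE guards (fun a => if a ∈ Y then v else pos a)
      (fun a z => hist a z ∨ (a ∈ Y ∧ z = v)) D' x' e' := by
  -- Density of `ℚ` leaves room for two fresh entries between `j` and the next old one.
  obtain ⟨r, hjr, hr⟩ : ∃ r : ℚ, j < r ∧ ∀ d ∈ D, j < d → r < d := by
    have : ∀ᶠ r in nhdsWithin j (Set.Ioi j), ∀ d ∈ D, j < d → r < d := by
      rw [Filter.eventually_all_finset]
      intro d _
      by_cases hd : j < d
      · filter_upwards [Ioo_mem_nhdsGT hd] with r hr _ using hr.2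
      · exact Filter.Eventually.of_forall fun _ h' => absurd h' hd
    obtain ⟨r, h1, h2⟩ := (this.and self_mem_nhdsWithin).exists
    exact ⟨r, h2, h1⟩
  obtain ⟨q, hjq, hqr⟩ := exists_between hjr
  have hcut : ∀ d ∈ D, d ≤ j ∨ r < d := fun d hd => (le_or_gt d j).imp_right (hr d hd)
  have hrD : r ∉ D := fun h' => (hcut r h').elim (fun h => by linarith) (lt_irrefl _)
  have hqD : q ∉ D := fun h' => (hcut q h').elim (fun h => by linarith) (fun h => by linarith)
  set S := staying guards hist e Y j with hS
  set x' : ℚ → V := fun d => if d = q then v else if d = r then x j else x d with hx'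
  set e' : α → ℚ := fun a => if a ∈ Y then q else if a ∈ S then r else e a with he'
  have hx'D : ∀ d ∈ D, x' d = x d := fun d hd => by
    simp [hx', ne_of_mem_of_not_mem hd hqD, ne_of_mem_of_not_mem hd hrD]
  have hx'q : x' q = v := by simp [hx']
  have hx'r : x' r = x j := by simp [hx', hqr.ne']
  have he'Y : ∀ a ∈ Y, e' a = q := fun a ha => by simp [he', ha]
  have he'S : ∀ a ∈ S, e' a = r := fun a ha => by simp [he', ha, (mem_staying.1 ha).1]
  have he'n : ∀ a, a ∉ Y → a ∉ S → e' a = e a := fun a ha ha' => by simp [he', ha, ha']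
  have hle : ∀ a, e a ≤ e' a := fun a => by
    by_cases ha : a ∈ Y
    · rw [he'Y a ha]; exact (hYj a ha).trans hjq.le
    by_cases ha' : a ∈ S
    · rw [he'S a ha', (mem_staying.1 ha').2.1]; exact hjr.le
    · rw [he'n a ha ha']
  have hlr : load e j ≤ load e' r := card_le_load fun a ha => by
    simp only [Finset.mem_filter, Finset.mem_univ, true_and] at ha
    exact (hr _ (h.e_mem a) ha).trans_le (hle a)
  have hlq : S.card + load e j ≤ load e' q := by
    rw [load, ← Finset.card_union_of_disjoint]
    · refine card_le_load fun a ha => ?_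
      rcases Finset.mem_union.1 ha with ha | ha
      · rw [he'S a ha]; exact hqr
      · simp only [Finset.mem_filter, Finset.mem_univ, true_and] at ha
        exact (hqr.trans (hr _ (h.e_mem a) ha)).trans_le (hle a)
    · rw [Finset.disjoint_left]
      intro a ha ha'
      simp only [Finset.mem_filter, Finset.mem_univ, true_and] at ha'
      exact ha'.ne' (mem_staying.1 ha).2.1
  have hYq : Y.card ≤ load e' q := by omega
  have hYl : ∀ d, d ≤ j → Y.card ≤ load e' d := fun d hd =>
    hYq.trans (load_anti (hd.trans hjq.le))
  have hset : ∀ a, GuardsVisited guards hist a →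
      GuardsVisited guards (fun a z => hist a z ∨ (a ∈ Y ∧ z = v)) a := by
    rintro a ⟨z, ⟨b, hb⟩, ha⟩; exact ⟨z, ⟨b, .inl hb⟩, ha⟩
  have hDD : D ⊆ insert q (insert r D) :=
    (Finset.subset_insert _ _).trans (Finset.subset_insert _ _)
  have hcond : ∀ {d d'}, d ∈ D → d' ∈ D → d ≤ d' → ∀ t, d' ≤ t →
      Linked G wE (load e d) (x' '' {p | p ∈ insert q (insert r D) ∧ p ≤ t})
        (x d) (x d') := by
    intro d d' hd hd' hdd t ht
    rcases hdd.eq_or_lt with rfl | hdd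
    · exact .refl
    refine (h.linked d hd d' hd' hdd).mono le_rfl ?_
    rintro _ ⟨p, ⟨hp, hpd⟩, rfl⟩
    exact ⟨p, ⟨hDD hp, hpd.trans ht⟩, hx'D p hp⟩
  have hstep : ∀ t, q ≤ t → Linked G wE Y.card
      (x' '' {p | p ∈ insert q (insert r D) ∧ p ≤ t}) (x j) v := fun t ht =>
    Linked.of_eq_or_adj hadj ⟨j, ⟨hDD hj, hjq.le.trans ht⟩, hx'D j hj⟩
      ⟨q, ⟨Finset.mem_insert_self _ _, ht⟩, hx'q⟩
  have hcases : ∀ d ∈ insert q (insert r D), d = q ∨ d = r ∨ d ∈ D := fun d hd => by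
    simpa using hd
  have hfr : ∀ a d, d ∈ D → e' a = d → a ∉ Y ∧ a ∉ S ∧ e a = d := fun a d hd ha => by
    have haY : a ∉ Y := fun haY => by rw [he'Y a haY] at ha; exact hqD (ha ▸ hd)
    have haS : a ∉ S := fun haS => by rw [he'S a haS] at ha; exact hrD (ha ▸ hd)
    exact ⟨haY, haS, by rw [← he'n a haY haS, ha]⟩
  have htop : ∃ a, r ≤ e' a := by
    rcases S.eq_empty_or_nonempty with hSe | ⟨a, ha⟩
    · have : 0 < load e j := by rw [hSe, Finset.card_empty] at hsmall; omega
      obtain ⟨a, ha⟩ := Finset.card_pos.1 this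
      simp only [Finset.mem_filter, Finset.mem_univ, true_and] at ha
      exact ⟨a, (hr _ (h.e_mem a) ha).le.trans (hle a)⟩
    · exact ⟨a, (he'S a ha).ge⟩
  refine ⟨insert q (insert r D), x', e', ?_⟩
  constructor
  · exact hDD h.zero_mem
  · intro d hd
    have hj0 := h.nonneg j hj
    rcases hcases d hd with rfl | rfl | hd
    · linarith
    · linarith
    · exact h.nonneg d hd
  · rw [hx'D 0 h.zero_mem, h.x_zero]
  · intro a
    by_cases ha : a ∈ Y
    · rw [he'Y a ha]; exact Finset.mem_insert_self _ _
    by_cases ha' : a ∈ S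
    · rw [he'S a ha']; exact Finset.mem_insert_of_mem (Finset.mem_insert_self _ _)
    · rw [he'n a ha ha']; exact hDD (h.e_mem a)
  · intro a
    by_cases ha : a ∈ Y
    · simp only [ha, if_true]; rw [he'Y a ha, hx'q]
    simp only [ha, if_false]
    by_cases ha' : a ∈ S
    · rw [he'S a ha', hx'r, ← (mem_staying.1 ha').2.1, h.x_e]
    · rw [he'n a ha ha', hx'D _ (h.e_mem a), h.x_e]
  · intro d hd
    rcases hcases d hd with rfl | rfl | hd
    · obtain ⟨a, ha⟩ := htop
      exact ⟨a, hqr.le.trans ha⟩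
    · exact htop
    · obtain ⟨a, ha⟩ := h.exists_le d hd
      exact ⟨a, ha.trans (hle a)⟩
  · intro d hd
    rcases hcases d hd with rfl | rfl | hd
    · obtain ⟨a, ha⟩ := hY
      exact ⟨a, .inr ⟨ha, hx'q⟩⟩
    · obtain ⟨b, hb⟩ := h.visited j hj
      exact ⟨b, .inl (by rwa [hx'r])⟩
    · obtain ⟨b, hb⟩ := h.visited d hd
      exact ⟨b, .inl (by rwa [hx'D d hd])⟩
  · intro d hd0 d' hd' hdd
    rcases hcases d hd0 with rfl | rfl | hd
    · rw [hx'q]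
      rcases hcases d' hd' with rfl | rfl | hd'
      · exact absurd hdd (lt_irrefl _)
      · rw [hx'r]
        exact (hstep _ hdd.le).symm.mono hYq le_rfl
      · rw [hx'D d' hd']
        have hjd : j ≤ d' := (hjq.trans hdd).le
        exact ((hstep _ hdd.le).symm.mono hYq le_rfl).trans
          ((hcond hj hd' hjd _ le_rfl).mono (by omega) le_rfl)
    · rw [hx'r]
      rcases hcases d' hd' with rfl | rfl | hd'
      · exact absurd hdd hqr.not_gt
      · exact absurd hdd (lt_irrefl _)
      · rw [hx'D d' hd']
        exact (hcond hj hd' (hjr.trans hdd).le _ le_rfl).mono hlr le_rfl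
    · rw [hx'D d hd]
      rcases hcases d' hd' with rfl | rfl | hd'
      · rw [hx'q]
        have hdj : d ≤ j := (hcut d hd).resolve_right fun h' => by linarith
        exact ((hcond hd hj hdj _ hjq.le).mono (load_mono hle d) le_rfl).trans
          ((hstep _ le_rfl).mono (hYl d hdj) le_rfl)
      · rw [hx'r]
        have hdj : d ≤ j := (hcut d hd).resolve_right fun h' => by linarith
        exact (hcond hd hj hdj _ hjr.le).mono (load_mono hle d) le_rfl
      · rw [hx'D d' hd']
        exact (hcond hd hd' hdd.le _ le_rfl).mono (load_mono hle d) le_rfl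
  · intro d hd0 d' hd' hdd
    rcases hcases d hd0 with rfl | rfl | hd
    · refine le_trans (Finset.card_le_card (t := Y) ?_) hYq
      intro a ha
      simp only [Finset.mem_filter, Finset.mem_univ, true_and] at ha
      by_contra haY
      by_cases haS : a ∈ S
      · rw [he'S a haS] at ha; exact hqr.ne' ha.1
      · rw [he'n a haY haS] at ha; exact hqD (ha.1 ▸ h.e_mem a)
    · have hd'D : d' ∈ D := by
        rcases hcases d' hd' with rfl | rfl | hd'
        · exact absurd hdd hqr.not_gt
        · exact absurd hdd (lt_irrefl _)
        · exact hd'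
      refine le_trans (Finset.card_le_card ?_)
        ((h.free_le j hj d' hd'D (hjr.trans hdd)).trans hlr)
      intro a ha
      simp only [Finset.mem_filter, Finset.mem_univ, true_and] at ha ⊢
      have haS : a ∈ S := by
        by_contra haS
        by_cases haY : a ∈ Y
        · rw [he'Y a haY] at ha; exact hqr.ne ha.1
        · rw [he'n a haY haS] at ha; exact hrD (ha.1 ▸ h.e_mem a)
      exact (mem_staying.1 haS).2
    · by_cases hdj : d = j
      · subst hdj
        -- No free agent remains at `j`: all of them went to `q` with `Y` or to `r` with `S`.
        convert Nat.zero_le _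
        rw [Finset.card_eq_zero, Finset.filter_eq_empty_iff]
        rintro a - ⟨ha, haf⟩
        obtain ⟨h1, h2, h3⟩ := hfr a d hd ha
        exact h2 (mem_staying.2 ⟨h1, h3, fun h' => haf (hset a h')⟩)
      -- The old `free_le` needs an old entry beyond `d`; if `d'` is one of the new ones, `j`
      -- serves.
      · have hd'' : ∃ d'' ∈ D, d < d'' := by
          rcases hcases d' hd' with rfl | rfl | hd'
          · exact ⟨j, hj, lt_of_le_of_ne
              ((hcut d hd).resolve_right fun h' => by linarith) hdj⟩
          · exact ⟨j, hj, lt_of_le_of_ne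
              ((hcut d hd).resolve_right fun h' => by linarith) hdj⟩
          · exact ⟨d', hd', hdd⟩
        obtain ⟨d'', hd''D, hdd''⟩ := hd''
        refine le_trans (Finset.card_le_card ?_)
          ((h.free_le d hd d'' hd''D hdd'').trans (load_mono hle d))
        intro a ha
        simp only [Finset.mem_filter, Finset.mem_univ, true_and] at ha ⊢
        exact ⟨(hfr a d hd ha.1).2.2, fun h' => ha.2 (hset a h')⟩
  · rintro a z (hz | ⟨ha, rfl⟩)
    · obtain ⟨d, hd, hda, hxd⟩ := h.hist_le a z hz
      exact ⟨d, hDD hd, hda.trans (hle a), by rw [hx'D d hd, hxd]⟩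
    · exact ⟨q, Finset.mem_insert_self _ _, (he'Y a ha).ge, hx'q⟩
  · intro z hz a ha d hd hxd
    by_cases hz' : ∃ b, hist b z
    · have hag : GuardsVisited guards hist a := ⟨z, hz', ha⟩
      rw [he'n a (fun haY => hfree a haY hag) fun haS => (mem_staying.1 haS).2.2 hag]
      have hold := h.guard_le z hz' a ha
      rcases hcases d hd with rfl | rfl | hd
      · rw [hx'q] at hxd
        subst hxd
        -- The choice of pivot matters here: an old occurrence of `v` at or before `j` keeps its
        -- guards at or before `j`.
        obtain ⟨d, hd, hdj, hxd⟩ := hvj hz'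
        exact ((hold d hd hxd).trans hdj).trans hjq.le
      · rw [hx'r] at hxd
        exact (hold j hj hxd).trans hjr.le
      · exact hold d hd (by rw [← hx'D d hd, hxd])
    · have hzv : z = v := by
        obtain ⟨b, hb | ⟨-, hb⟩⟩ := hz
        · exact absurd ⟨b, hb⟩ hz'
        · exact hb
      subst hzv
      rw [he'Y a (hguard hz' a ha)]
      rcases hcases d hd with rfl | rfl | hd
      · exact le_rfl
      · exact hqr.le
      · exact absurd (hxd ▸ hx'D d hd ▸ h.visited d hd) hz'

open Classical in
/-- Arrangements persist if a set `Y` of agents that are not settled moves to a vertex `v`. -/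
theorem move (h : IsArrangement G s wE guards pos hist D x e) {Y : Finset α} {v : V}
    (hY : Y.Nonempty) (hfree : ∀ a ∈ Y, ¬ GuardsVisited guards hist a)
    (hadj : ∀ a ∈ Y, G.Adj (pos a) v ∧ wE s(pos a, v) ≤ Y.card)
    (hguard : (¬ ∃ b, hist b v) → ∀ a ∈ guards v, a ∈ Y) :
    ∃ D' x' e', IsArrangement G s wE guards (fun a => if a ∈ Y then v else pos a)
      (fun a z => hist a z ∨ (a ∈ Y ∧ z = v)) D' x' e' := by
  obtain ⟨j, hj, hYj, hvj, hjv⟩ := h.exists_pivot hY hadj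
  rcases le_or_gt ((staying guards hist e Y j).card + load e j) Y.card with hle | hlt
  · exact h.append_entry hY hfree hguard hj hYj hvj hjv hle
  · exact h.insert_entry hY hfree hguard hj hYj hvj hjv hlt

end IsArrangement

/-! ### Arrangements along a schedule -/

namespace Schedule

variable {V : Type*} {G : SimpleGraph V} {s : V} {k : ℕ}

open Classical in
/-- The positions after those agents have made their move at time `t` that move into `W`. -/
noncomputable def partialPos (σ : Schedule G s k) (t : ℕ) (W : Finset V) (a : Fin k) : V :=
  if σ.pos (t + 1) a ∈ W then σ.pos (t + 1) a else σ.pos t a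

/-- The visits after those agents have made their move at time `t` that move into `W`. -/
def partialHist (σ : Schedule G s k) (t : ℕ) (W : Finset V) (a : Fin k) (z : V) : Prop :=
  (∃ t' ≤ t, σ.pos t' a = z) ∨ (z ∈ W ∧ σ.pos (t + 1) a = z)

/-- There is an arrangement of the agents with positions `pos` and visits `hist`. -/
def HasArrangement (σ : Schedule G s k) (wE : Sym2 V → ℕ) (pos : Fin k → V)
    (hist : Fin k → V → Prop) : Prop :=
  ∃ D x e, IsArrangement G s wE σ.guards pos hist D x e

theorem hasArrangement_zero (σ : Schedule G s k) (wE : Sym2 V → ℕ) (hk : 0 < k) :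
    σ.HasArrangement wE (σ.pos 0) (fun a z => ∃ t ≤ 0, σ.pos t a = z) := by
  refine ⟨{0}, fun _ => s, fun _ => 0, ?_⟩
  constructor
  · simp
  · simp
  · rfl
  · simp
  · intro a; exact (σ.start a).symm
  · intro d hd; exact ⟨⟨0, hk⟩, by simp_all⟩
  · intro d _; exact ⟨⟨0, hk⟩, 0, le_rfl, σ.start _⟩
  · intro d hd d' hd' hdd; simp_all
  · intro d hd d' hd' hdd; simp_all
  · rintro a z ⟨t, ht, rfl⟩
    obtain rfl : t = 0 := by omega
    exact ⟨0, by simp, le_rfl, (σ.start a).symm⟩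
  · intro v _ a _ d hd _; simp_all

theorem visitedBy_of_partialHist {σ : Schedule G s k} {t : ℕ} {W : Finset V} {v : V} {b : Fin k}
    (h : σ.partialHist t W b v) : σ.VisitedBy (t + 1) v := by
  obtain ⟨t', ht', hb⟩ | ⟨-, hb⟩ := h
  · exact ⟨t', by omega, b, hb⟩
  · exact ⟨t + 1, le_rfl, b, hb⟩

variable [DecidableEq V] {wV : V → ℕ} {wE : Sym2 V → ℕ} {σ : Schedule G s k}

theorem Valid.pos_eq_of_guardsVisited (hσ : σ.Valid wV wE) {t : ℕ} (ht : t < σ.horizon)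
    {W : Finset V} {a : Fin k} (ha : GuardsVisited σ.guards (σ.partialHist t W) a)
    (haW : σ.pos (t + 1) a ∉ W) : σ.pos t a = σ.pos (t + 1) a := by
  obtain ⟨v, ⟨b, hb⟩, hav⟩ := ha
  have h1 := hσ.guards_stay (t + 1) ht v (visitedBy_of_partialHist hb) a hav
  obtain ⟨t', ht', hb⟩ | ⟨hvW, -⟩ := hb
  · rw [h1, hσ.guards_stay t ht.le v ⟨t', ht', b, hb⟩ a hav]
  · exact absurd (h1 ▸ hvW) haW

/-- Collecting all agents that enter `v`, from whatever neighbours, gives a set at least as large as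
the force on each edge used. Guards of vertices known so far do not move into `v`, and if `v` is
new, all its guards must be among the arrivals. -/
theorem Valid.hasArrangement_insert (hσ : σ.Valid wV wE) {t : ℕ} (ht : t < σ.horizon)
    {W : Finset V} {v : V} (hv : v ∉ W)
    (h : σ.HasArrangement wE (σ.partialPos t W) (σ.partialHist t W)) :
    σ.HasArrangement wE (σ.partialPos t (insert v W)) (σ.partialHist t (insert v W)) := by
  classical
  obtain ⟨D, x, e, h⟩ := h
  set Y : Finset (Fin k) :=
    Finset.univ.filter fun a => σ.pos (t + 1) a = v ∧ σ.pos t a ≠ v with hYdef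
  have hmem : ∀ a, a ∈ Y ↔ σ.pos (t + 1) a = v ∧ σ.pos t a ≠ v := fun a => by simp [hYdef]
  have hpos : σ.partialPos t (insert v W) = fun a => if a ∈ Y then v else σ.partialPos t W a := by
    funext a
    simp only [partialPos, hmem, Finset.mem_insert]
    by_cases h1 : σ.pos (t + 1) a = v
    · by_cases h2 : σ.pos t a = v <;> simp [h1, h2, hv]
    · simp [h1]
  have hhist : σ.partialHist t (insert v W) =
      fun a z => σ.partialHist t W a z ∨ (a ∈ Y ∧ z = v) := by
    funext a z
    simp only [partialHist, hmem, Finset.mem_insert, eq_iff_iff]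
    constructor
    · rintro (h | ⟨rfl | h, h'⟩)
      · exact .inl (.inl h)
      · by_cases h2 : σ.pos t a = z
        · exact .inl (.inl ⟨t, le_rfl, h2⟩)
        · exact .inr ⟨⟨h', h2⟩, rfl⟩
      · exact .inl (.inr ⟨h, h'⟩)
    · rintro ((h | ⟨h, h'⟩) | ⟨⟨h, -⟩, rfl⟩)
      · exact .inl h
      · exact .inr ⟨.inr h, h'⟩
      · exact .inr ⟨.inl rfl, h⟩
  rw [hpos, hhist]
  rcases Y.eq_empty_or_nonempty with hY | hY
  · refine ⟨D, x, e, ?_⟩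
    simpa [hY] using h
  have hvis : σ.VisitedBy (t + 1) v := by
    obtain ⟨a, ha⟩ := hY
    exact ⟨t + 1, le_rfl, a, ((hmem a).1 ha).1⟩
  have hmove : (∀ a ∈ Y, ¬ GuardsVisited σ.guards (σ.partialHist t W) a) →
      (∀ a ∈ Y, G.Adj (σ.partialPos t W a) v ∧ wE s(σ.partialPos t W a, v) ≤ Y.card) →
      ((¬ ∃ b, σ.partialHist t W b v) → ∀ a ∈ σ.guards v, a ∈ Y) →
      σ.HasArrangement wE (fun a => if a ∈ Y then v else σ.partialPos t W a)
        (fun a z => σ.partialHist t W a z ∨ (a ∈ Y ∧ z = v)) := fun h1 h2 h3 => by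
    obtain ⟨D', x', e', hm⟩ := h.move hY h1 h2 h3
    refine ⟨D', x', e', ?_⟩
    convert hm
  refine hmove ?_ ?_ ?_
  · intro a ha hs
    obtain ⟨h1, h2⟩ := (hmem a).1 ha
    exact h2 ((hσ.pos_eq_of_guardsVisited ht hs (h1 ▸ hv)).trans h1)
  · intro a ha
    obtain ⟨h1, h2⟩ := (hmem a).1 ha
    have h3 : σ.partialPos t W a = σ.pos t a := by simp [partialPos, h1, hv]
    rw [h3]
    constructor
    · rcases σ.step t ht a with h | h
      · exact absurd (h ▸ h1) h2
      · rwa [h1] at h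
    · have := hσ.edge t ht a (by rw [h1]; exact fun h => h2 h.symm)
      rw [h1] at this
      refine this.trans (Finset.card_le_card fun b hb => ?_)
      simp only [Finset.mem_filter, Finset.mem_univ, true_and] at hb
      exact (hmem b).2 ⟨hb.2, hb.1 ▸ h2⟩
  · intro hn a ha
    refine (hmem a).2 ⟨hσ.guards_stay (t + 1) ht v hvis a ha, fun h => hn ⟨a, .inl ⟨t, le_rfl, h⟩⟩⟩

/-- At every time the agents of a deployment strategy can be arranged. -/
theorem Valid.hasArrangement [Fintype V] (hσ : σ.Valid wV wE) (hk : 0 < k) {t : ℕ}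
    (ht : t ≤ σ.horizon) :
    σ.HasArrangement wE (σ.pos t) (fun a z => ∃ t' ≤ t, σ.pos t' a = z) := by
  induction t with
  | zero => exact σ.hasArrangement_zero wE hk
  | succ t ih =>
    -- The simultaneous moves of a step are serialized by destination, in any order.
    have key : ∀ W : Finset V, σ.HasArrangement wE (σ.partialPos t W) (σ.partialHist t W) := by
      intro W
      induction W using Finset.induction_on with
      | empty =>
        convert ih (by omega) using 1
        · funext a; simp [partialPos]
        · funext a z; simp [partialHist]
      | insert v W hv ihW => exact hσ.hasArrangement_insert ht hv ihW
    convert key Finset.univ using 1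
    · funext a; simp [partialPos]
    · funext a z
      simp only [partialHist, Finset.mem_univ, true_and, eq_iff_iff]
      constructor
      · rintro ⟨t', ht', h⟩
        rcases Nat.le_succ_iff.1 ht' with h' | rfl
        · exact .inl ⟨t', h', h⟩
        · exact .inr h
      · rintro (⟨t', ht', h⟩ | h)
        · exact ⟨t', by omega, h⟩
        · exact ⟨t + 1, le_rfl, h⟩

end Schedule

/-! ### Tours of a single group -/

/-- A single group of initially `k` agents can, starting at `s`, visit exactly the vertices of `T`
and end in `x`, where `wV v` agents are left behind at every visited vertex `v`. -/
def GroupTour {V : Type*} [DecidableEq V] (G : SimpleGraph V) (s : V) (wV : V → ℕ)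
    (wE : Sym2 V → ℕ) (k : ℕ) (T : Finset V) (x : V) : Prop :=
  ∃ (h : ℕ) (p : ℕ → V), p 0 = s ∧ p h = x ∧ (Finset.range (h + 1)).image p = T ∧
    ∀ t < h, G.Adj (p t) (p (t + 1)) ∧ (∑ v ∈ (Finset.range (t + 1)).image p, wV v) < k ∧
      wE s(p t, p (t + 1)) + ∑ v ∈ (Finset.range (t + 1)).image p, wV v ≤ k

namespace GroupTour

variable {V : Type*} [DecidableEq V] {G : SimpleGraph V} {s : V} {wV : V → ℕ}
  {wE : Sym2 V → ℕ} {k : ℕ} {T : Finset V} {x y z : V}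

theorem start : GroupTour G s wV wE k {s} s :=
  ⟨0, fun _ => s, rfl, rfl, by simp, by simp⟩

theorem step (h : GroupTour G s wV wE k T x) (hxy : G.Adj x y) (hk : ∑ v ∈ T, wV v < k)
    (hw : wE s(x, y) + ∑ v ∈ T, wV v ≤ k) : GroupTour G s wV wE k (insert y T) y := by
  obtain ⟨n, p, h0, hn, hT, hp⟩ := h
  have himg : ∀ t ≤ n, (Finset.range (t + 1)).image (fun i => if i ≤ n then p i else y) =
      (Finset.range (t + 1)).image p := fun t ht => by
    refine Finset.image_congr fun i hi => ?_
    have : i ≤ n := by simp at hi; omega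
    simp [this]
  refine ⟨n + 1, fun i => if i ≤ n then p i else y, by simpa using h0, by simp, ?_, ?_⟩
  · rw [Finset.range_add_one, Finset.image_insert, himg n le_rfl, hT]; simp
  · intro t ht
    rw [himg t (by omega)]
    rcases Nat.lt_succ_iff_lt_or_eq.1 ht with ht | rfl
    · simpa [ht.le, Nat.succ_le_of_lt ht] using hp t ht
    · simp [hn, hT, hxy, hk, hw]

/-- The path stays inside the visited set until it meets `z`. Up to then nobody new settles, so the
group keeps its size; at `z` the walk is cut off. -/
theorem of_linked (h : GroupTour G s wV wE k T x) {c : ℕ} (hk : ∑ v ∈ T, wV v < k)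
    (hc : c + ∑ v ∈ T, wV v ≤ k) (hl : Linked G wE c ↑(insert z T) x y) (hx : x ∈ T) :
    (y ∈ T ∧ GroupTour G s wV wE k T y) ∨ GroupTour G s wV wE k (insert z T) z := by
  unfold Linked at hl
  induction hl with
  | refl => exact .inl ⟨hx, h⟩
  | @tail b c' _ hbc ih =>
    rcases ih with ⟨-, ih⟩ | ih
    · have hs := ih.step hbc.1 hk ((Nat.add_le_add_right hbc.2.2.2 _).trans hc)
      rcases Finset.mem_insert.1 (Finset.mem_coe.1 hbc.2.2.1) with rfl | hcT
      · exact .inr hs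
      · rw [Finset.insert_eq_of_mem hcT] at hs
        exact .inl ⟨hcT, hs⟩
    · exact .inr ih

theorem of_linked_self (h : GroupTour G s wV wE k T x) {c : ℕ} (hk : ∑ v ∈ T, wV v < k)
    (hc : c + ∑ v ∈ T, wV v ≤ k) (hl : Linked G wE c ↑(insert z T) x z) (hx : x ∈ T) :
    GroupTour G s wV wE k (insert z T) z := by
  rcases h.of_linked hk hc hl hx with ⟨hz, h⟩ | h
  · rwa [Finset.insert_eq_of_mem hz]
  · exact h

end GroupTour

/-! ### From arrangements to tours -/

theorem load_add_card {α : Type*} [Fintype α] (e : α → ℚ) (d : ℚ) :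
    load e d + (Finset.univ.filter fun a => e a ≤ d).card = Fintype.card α := by
  simpa [load] using Finset.card_filter_add_card_filter_not (s := Finset.univ) (fun a => d < e a)

/-- A single group can visit the vertices of an arrangement in increasing order. -/
theorem IsArrangement.groupTour {V α : Type*} [Fintype α] [DecidableEq V] {G : SimpleGraph V}
    {s : V} {wE : Sym2 V → ℕ} {guards : V → Finset α} {pos : α → V} {hist : α → V → Prop}
    {D : Finset ℚ} {x : ℚ → V} {e : α → ℚ} (h : IsArrangement G s wE guards pos hist D x e)
    (hdis : ∀ u v, u ≠ v → Disjoint (guards u) (guards v)) {d : ℚ} (hd : d ∈ D) :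
    GroupTour G s (fun v => (guards v).card) wE (Fintype.card α)
      ((D.filter (· ≤ d)).image x) (x d) := by
  obtain ⟨n, hn⟩ : ∃ n, (D.filter (· < d)).card = n := ⟨_, rfl⟩
  induction n using Nat.strong_induction_on generalizing d with
  | _ n ih =>
    rcases (D.filter (· < d)).eq_empty_or_nonempty with hemp | hne
    · have hd0 : d = 0 := le_antisymm
        (not_lt.1 fun h' => by simpa [h.zero_mem, h'] using Finset.ext_iff.1 hemp 0) (h.nonneg d hd)
      subst hd0
      have : D.filter (· ≤ 0) = {0} := by
        ext p
        simp only [Finset.mem_filter, Finset.mem_singleton]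
        exact ⟨fun hp => le_antisymm hp.2 (h.nonneg p hp.1), fun hp => by rw [hp]; exact ⟨hd, le_rfl⟩⟩
      rw [this, Finset.image_singleton, h.x_zero]
      exact GroupTour.start
    · obtain ⟨d', hd', hmax⟩ := Finset.exists_max_image _ id hne
      simp only [Finset.mem_filter, id, and_imp] at hd' hmax
      have htour := ih (D.filter (· < d')).card (by
        rw [← hn]
        refine Finset.card_lt_card ⟨fun p hp => ?_, fun hsub => ?_⟩
        · simp only [Finset.mem_filter] at hp ⊢
          exact ⟨hp.1, hp.2.trans hd'.2⟩
        · have := hsub (Finset.mem_filter.2 hd')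
          simp at this) hd'.1 rfl
      have hins : (D.filter (· ≤ d)).image x = insert (x d) ((D.filter (· ≤ d')).image x) := by
        rw [← Finset.image_insert]
        congr 1
        ext p
        simp only [Finset.mem_filter, Finset.mem_insert]
        constructor
        · rintro ⟨hp, hpd⟩
          rcases hpd.eq_or_lt with rfl | hpd
          · exact .inl rfl
          · exact .inr ⟨hp, hmax p hp hpd⟩
        · rintro (rfl | ⟨hp, hpd⟩)
          · exact ⟨hd, le_rfl⟩
          · exact ⟨hp, hpd.trans hd'.2.le⟩
      -- By `guard_le`, the agents left behind so far all have entries up to `d'`, so those beyond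
      -- `d'` are still available to the group.
      have hsum : ∑ v ∈ (D.filter (· ≤ d')).image x, (guards v).card ≤
          (Finset.univ.filter fun a => e a ≤ d').card := by
        classical
        rw [← Finset.card_biUnion fun u _ v _ huv => hdis u v huv]
        refine Finset.card_le_card fun a ha => ?_
        simp only [Finset.mem_biUnion, Finset.mem_image, Finset.mem_filter] at ha
        obtain ⟨_, ⟨p, ⟨hp, hpd⟩, rfl⟩, ha⟩ := ha
        simp only [Finset.mem_filter, Finset.mem_univ, true_and]
        exact (h.guard_le _ (h.visited p hp) a ha p hp rfl).trans hpd
      have hload := load_add_card e d'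
      have hpos : 0 < load e d' := by
        obtain ⟨a, ha⟩ := h.exists_le d hd
        exact Finset.card_pos.2 ⟨a, by simpa using hd'.2.trans_le ha⟩
      rw [hins]
      refine htour.of_linked_self (c := load e d') (by omega) (by omega) ?_ ?_
      · refine (h.linked d' hd'.1 d hd hd'.2).mono le_rfl ?_
        rw [← hins]
        rintro _ ⟨p, hp, rfl⟩
        exact Finset.mem_coe.2 (Finset.mem_image_of_mem x (Finset.mem_filter.2 hp))
      · exact Finset.mem_image_of_mem x (Finset.mem_filter.2 ⟨hd'.1, le_rfl⟩)

namespace Schedule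

variable {V : Type*} [DecidableEq V] {G : SimpleGraph V} {s : V} {k : ℕ}
  {wV : V → ℕ} {wE : Sym2 V → ℕ} {σ : Schedule G s k}

theorem Valid.disjoint_guards (hσ : σ.Valid wV wE) (u v : V) (huv : u ≠ v) :
    Disjoint (σ.guards u) (σ.guards v) := by
  rw [Finset.disjoint_left]
  intro a hu hv
  exact huv ((hσ.guards_stay _ le_rfl u (hσ.all_visited u) a hu).symm.trans
    (hσ.guards_stay _ le_rfl v (hσ.all_visited v) a hv))

/-- If the agents of `A` together visit all vertices, then a single group can visit all vertices
and end where some member of `A` ends. -/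
theorem Valid.groupTour [Fintype V] (hσ : σ.Valid wV wE) {A : Finset (Fin k)}
    (hA : ∀ v, ∃ a ∈ A, ∃ t ≤ σ.horizon, σ.pos t a = v) :
    ∃ a ∈ A, GroupTour G s wV wE k Finset.univ (σ.pos σ.horizon a) := by
  have hne : A.Nonempty := by
    obtain ⟨a, ha, -⟩ := hA s
    exact ⟨a, ha⟩
  have hk : 0 < k := Fin.pos hne.choose
  obtain ⟨D, x, e, h⟩ := hσ.hasArrangement hk (le_refl σ.horizon)
  -- Everything seen by a member of `A` occurs at or before the rightmost member's entry, so the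
  -- tour can stop there.
  obtain ⟨a, haA, ha⟩ := A.exists_max_image e hne
  refine ⟨a, haA, ?_⟩
  have ht := h.groupTour hσ.disjoint_guards (h.e_mem a)
  simp only [hσ.guards_card, Fintype.card_fin] at ht
  rw [h.x_e] at ht
  convert ht
  refine (Finset.eq_univ_of_forall fun z => ?_).symm
  obtain ⟨b, hb, hbz⟩ := hA z
  obtain ⟨d, hd, hdb, rfl⟩ := h.hist_le b z hbz
  exact Finset.mem_image_of_mem x (Finset.mem_filter.2 ⟨hd, hdb.trans (ha b hb)⟩)

end Schedule

/-! ### From tours to schedules -/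

theorem card_unsettled {V : Type*} {k : ℕ} {guards : V → Finset (Fin k)}
    (hdis : ∀ u v, u ≠ v → Disjoint (guards u) (guards v)) (T : Finset V) :
    (Finset.univ.filter fun a : Fin k => ∀ v ∈ T, a ∉ guards v).card +
      ∑ v ∈ T, (guards v).card = k := by
  rw [← Finset.card_biUnion fun u _ v _ huv => hdis u v huv, ← Finset.card_union_of_disjoint]
  · conv_rhs => rw [← Fintype.card_fin k, ← Finset.card_univ]
    congr 1
    ext a
    simp only [Finset.mem_union, Finset.mem_filter, Finset.mem_univ, true_and,
      Finset.mem_biUnion, iff_true]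
    by_cases ha : ∃ v ∈ T, a ∈ guards v
    · exact .inr ha
    · exact .inl fun v hv hav => ha ⟨v, hv, hav⟩
  · rw [Finset.disjoint_left]
    intro a ha ha'
    simp only [Finset.mem_filter, Finset.mem_univ, true_and, Finset.mem_biUnion] at ha ha'
    obtain ⟨v, hv, hav⟩ := ha'
    exact ha v hv hav

section TourSchedule

variable {V : Type*} [DecidableEq V] {G : SimpleGraph V} {s : V} {k : ℕ}

open Classical in
/-- All agents follow the walk `p`, except that the members of `guards v` stay at `v` as soon as
they get there. -/
noncomputable def followSchedule (guards : V → Finset (Fin k)) (h : ℕ) (p : ℕ → V)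
    (h0 : p 0 = s) (hp : ∀ t < h, G.Adj (p t) (p (t + 1)))
    (hdis : ∀ u v, u ≠ v → Disjoint (guards u) (guards v)) : Schedule G s k where
  horizon := h
  pos t a := if hv : ∃ v ∈ (Finset.range (t + 1)).image p, a ∈ guards v then hv.choose else p t
  guards := guards
  start a := by
    split_ifs with hv
    · have := hv.choose_spec.1
      simpa [h0] using this
    · exact h0
  step t ht a := by
    by_cases hv : ∃ v ∈ (Finset.range (t + 1)).image p, a ∈ guards v
    · have hv' : ∃ v ∈ (Finset.range (t + 1 + 1)).image p, a ∈ guards v := by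
        obtain ⟨v, hv, ha⟩ := hv
        exact ⟨v, Finset.image_subset_image (by simp) hv, ha⟩
      left
      rw [dif_pos hv, dif_pos hv']
      by_contra hne
      exact Finset.disjoint_left.1 (hdis _ _ hne) hv'.choose_spec.2 hv.choose_spec.2
    · right
      rw [dif_neg hv]
      split_ifs with hv'
      · have h1 := hv'.choose_spec
        generalize hv'.choose = v at h1 ⊢
        rw [Finset.range_add_one, Finset.image_insert, Finset.mem_insert] at h1
        rcases h1.1 with h2 | h2
        · rw [h2]; exact hp t ht
        · exact absurd ⟨_, h2, h1.2⟩ hv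
      · exact hp t ht

variable {guards : V → Finset (Fin k)} {h : ℕ} {p : ℕ → V} {h0 : p 0 = s}
  {hp : ∀ t < h, G.Adj (p t) (p (t + 1))}
  {hdis : ∀ u v, u ≠ v → Disjoint (guards u) (guards v)}

theorem followSchedule_pos_of_mem {t : ℕ} {a : Fin k} {v : V}
    (hv : v ∈ (Finset.range (t + 1)).image p) (ha : a ∈ guards v) :
    (followSchedule guards h p h0 hp hdis).pos t a = v := by
  have hv' : ∃ v ∈ (Finset.range (t + 1)).image p, a ∈ guards v := ⟨v, hv, ha⟩
  simp only [followSchedule]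
  rw [dif_pos hv']
  by_contra hne
  exact Finset.disjoint_left.1 (hdis _ _ hne) hv'.choose_spec.2 ha

theorem followSchedule_pos_of_forall {t : ℕ} {a : Fin k}
    (ha : ∀ v ∈ (Finset.range (t + 1)).image p, a ∉ guards v) :
    (followSchedule guards h p h0 hp hdis).pos t a = p t :=
  dif_neg fun ⟨v, hv, hav⟩ => ha v hv hav

theorem followSchedule_pos_succ {t : ℕ} {a : Fin k}
    (ha : ∀ v ∈ (Finset.range (t + 1)).image p, a ∉ guards v) :
    (followSchedule guards h p h0 hp hdis).pos (t + 1) a = p (t + 1) := by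
  by_cases hv : a ∈ guards (p (t + 1))
  · exact followSchedule_pos_of_mem (Finset.mem_image_of_mem p (by simp)) hv
  · refine followSchedule_pos_of_forall fun v hv' => ?_
    rw [Finset.range_add_one, Finset.image_insert, Finset.mem_insert] at hv'
    rcases hv' with rfl | hv'
    · exact hv
    · exact ha v hv'

end TourSchedule

/-- A tour of a single group through all vertices is a deployment strategy. -/
theorem GroupTour.exists_schedule {V : Type*} [Fintype V] [DecidableEq V] {G : SimpleGraph V}
    {s : V} {wV : V → ℕ} {wE : Sym2 V → ℕ} {k : ℕ} {x : V}
    (htour : GroupTour G s wV wE k Finset.univ x) (hk : 0 < k) {guards : V → Finset (Fin k)}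
    (hcard : ∀ v, (guards v).card = wV v)
    (hdis : ∀ u v, u ≠ v → Disjoint (guards u) (guards v)) :
    ∃ σ : Schedule G s k, σ.Valid wV wE ∧ σ.SingleGroup ∧
      ∀ a, (∀ v, a ∉ guards v) → σ.pos σ.horizon a = x ∧ ∀ v, ∃ t ≤ σ.horizon, σ.pos t a = v := by
  obtain ⟨h, p, h0, hx, himg, hp⟩ := htour
  let σ : Schedule G s k := followSchedule guards h p h0 (fun t ht => (hp t ht).1) hdis
  have hmem : ∀ {t v}, v ∈ (Finset.range (t + 1)).image p ↔ ∃ t' ≤ t, p t' = v := by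
    simp
  have hpos : ∀ {t a v}, v ∈ (Finset.range (t + 1)).image p → a ∈ guards v → σ.pos t a = v :=
    fun hv ha => followSchedule_pos_of_mem hv ha
  have hfree : ∀ {t a}, (∀ v ∈ (Finset.range (t + 1)).image p, a ∉ guards v) → σ.pos t a = p t :=
    fun ha => followSchedule_pos_of_forall ha
  have hsucc : ∀ {t a}, (∀ v ∈ (Finset.range (t + 1)).image p, a ∉ guards v) →
      σ.pos (t + 1) a = p (t + 1) := fun ha => followSchedule_pos_succ ha
  have hcount : ∀ t, (Finset.univ.filter fun a : Fin k =>
      ∀ v ∈ (Finset.range (t + 1)).image p, a ∉ guards v).card +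
      ∑ v ∈ (Finset.range (t + 1)).image p, wV v = k := fun t => by
    have := card_unsettled hdis ((Finset.range (t + 1)).image p)
    simp only [hcard] at this
    convert this
  have hvis : ∀ {t v}, t ≤ h → (σ.VisitedBy t v ↔ v ∈ (Finset.range (t + 1)).image p) := by
    intro t v ht
    constructor
    · rintro ⟨t', ht', a, rfl⟩
      by_cases ha : ∃ v ∈ (Finset.range (t' + 1)).image p, a ∈ guards v
      · obtain ⟨v, hv, hav⟩ := ha
        rw [hpos hv hav]
        exact Finset.image_subset_image (by simpa using ht') hv
      · rw [hfree fun v hv hav => ha ⟨v, hv, hav⟩]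
        exact hmem.2 ⟨t', ht', rfl⟩
    · intro hv
      obtain ⟨t', ht', rfl⟩ := hmem.1 hv
      rcases t' with _ | t'
      · exact ⟨0, by omega, ⟨0, hk⟩, by rw [σ.start, h0]⟩
      · have h1 := hcount t'
        -- The strict inequality leaves somebody to make the move even if the edge weight is zero.
        have h2 := (hp t' (by omega)).2.1
        obtain ⟨a, ha⟩ := Finset.card_pos.1 (show 0 < (Finset.univ.filter fun a : Fin k =>
          ∀ v ∈ (Finset.range (t' + 1)).image p, a ∉ guards v).card by omega)
        exact ⟨t' + 1, ht', a, hsucc (by simpa using ha)⟩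
  have hunset : ∀ {t a}, t ≤ h → ¬ σ.Settled t a →
      ∀ v ∈ (Finset.range (t + 1)).image p, a ∉ guards v :=
    fun ht ha v hv hav => ha ⟨v, (hvis ht).2 hv, hav⟩
  refine ⟨σ, ⟨?_, hcard, ?_, ?_⟩, ⟨?_, ?_⟩, ?_⟩
  · intro t ht a hne
    change t < h at ht
    have ha : ∀ v ∈ (Finset.range (t + 1)).image p, a ∉ guards v := by
      intro v hv hav
      refine hne ?_
      rw [hpos hv hav, hpos (Finset.image_subset_image (by simp) hv) hav]
    rw [hfree ha, hsucc ha]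
    have h1 := hcount t
    have h2 := (hp t ht).2.2
    have h3 := Finset.card_le_card (s := Finset.univ.filter fun a : Fin k =>
      ∀ v ∈ (Finset.range (t + 1)).image p, a ∉ guards v)
      (t := Finset.univ.filter fun b : Fin k => σ.pos t b = p t ∧ σ.pos (t + 1) b = p (t + 1))
      fun b hb => by
        simp only [Finset.mem_filter, Finset.mem_univ, true_and] at hb ⊢
        exact ⟨hfree hb, hsucc hb⟩
    refine le_trans (by omega) (h3.trans (le_of_eq ?_))
    congr
  · intro t ht v hv a ha
    exact hpos ((hvis ht).1 hv) ha
  · intro v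
    exact (hvis (t := h) le_rfl).2 (himg ▸ Finset.mem_univ v)
  · intro t ht a b ha hb
    rw [hfree (hunset ht ha), hfree (hunset ht hb)]
  · intro t ht a b ha hb
    rw [hsucc (hunset (le_of_lt ht) ha), hsucc (hunset (le_of_lt ht) hb)]
  · intro a ha
    refine ⟨(hfree fun v _ => ha v).trans hx, fun v => ?_⟩
    obtain ⟨t, ht, htv⟩ := hmem.1 (himg ▸ Finset.mem_univ v : v ∈ (Finset.range (h + 1)).image p)
    exact ⟨t, ht, (hfree fun v _ => ha v).trans htv⟩

/-! ### Existence of some strategy -/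

/-- With many agents a single group can visit all vertices and return. -/
theorem GroupTour.exists_of_connected {V : Type*} [Fintype V] [DecidableEq V] {G : SimpleGraph V}
    (hG : G.Connected) (s : V) {wV : V → ℕ} {wE : Sym2 V → ℕ} {k : ℕ}
    (hk : ∀ e, wE e + ∑ v, wV v < k) : GroupTour G s wV wE k Finset.univ s := by
  have hsum : ∀ T : Finset V, ∑ v ∈ T, wV v ≤ ∑ v, wV v := fun T =>
    Finset.sum_le_sum_of_subset (Finset.subset_univ T)
  have hgo : ∀ {T x} y, x ∈ T → GroupTour G s wV wE k T x →
      ∃ T', T ⊆ T' ∧ y ∈ T' ∧ GroupTour G s wV wE k T' y := by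
    intro T x y hx hT
    obtain ⟨w⟩ := hG.preconnected x y
    induction w generalizing T with
    | nil => exact ⟨T, le_rfl, hx, hT⟩
    | @cons a b c hab _ ih =>
      have h1 := hk s(a, b)
      have h2 := hsum T
      obtain ⟨T', hsub, hc, hT'⟩ :=
        ih (Finset.mem_insert_self b T) (hT.step hab (by omega) (by omega))
      exact ⟨T', (Finset.subset_insert b T).trans hsub, hc, hT'⟩
  have hall : ∀ R : Finset V, ∃ T x, R ⊆ T ∧ x ∈ T ∧ GroupTour G s wV wE k T x := by
    intro R
    induction R using Finset.induction_on with
    | empty => exact ⟨{s}, s, Finset.empty_subset _, Finset.mem_singleton_self s, start⟩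
    | insert y R _ ih =>
      obtain ⟨T, x, hR, hx, hT⟩ := ih
      obtain ⟨T', hsub, hy, hT'⟩ := hgo y hx hT
      exact ⟨T', y, Finset.insert_subset hy (hR.trans hsub), hy, hT'⟩
  obtain ⟨T, x, hR, hx, hT⟩ := hall Finset.univ
  obtain ⟨T', hsub, -, hT'⟩ := hgo s hx hT
  rwa [Finset.univ_subset_iff.1 (hR.trans hsub)] at hT'

/-- With sufficiently many agents there is a deployment strategy. -/
theorem exists_isDeployment {V : Type*} [Fintype V] [DecidableEq V] {G : SimpleGraph V}
    (hG : G.Connected) (s : V) (wV : V → ℕ) (wE : Sym2 V → ℕ) (var : DeploymentVariant) :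
    ∃ k, ∃ σ : Schedule G s k, σ.IsDeployment wV wE var := by
  -- The spare agents outnumber every edge weight; being at least one, they also supply an agent
  -- without a guard duty that can report back.
  let c : ℕ := (∑ e, wE e) + 1
  let ι := (Σ v, Fin (wV v)) ⊕ Fin c
  let f : ι ≃ Fin (Fintype.card ι) := Fintype.equivFin ι
  have hcardι : Fintype.card ι = ∑ v, wV v + c := by simp [ι]
  let guards : V → Finset (Fin (Fintype.card ι)) := fun v =>
    (Finset.univ : Finset (Fin (wV v))).map
      ⟨fun i => f (.inl ⟨v, i⟩), fun i j hij =>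
        eq_of_heq (Sigma.mk.inj (Sum.inl.inj (f.injective hij))).2⟩
  have hmem : ∀ {v a}, a ∈ guards v ↔ ∃ i, f (.inl ⟨v, i⟩) = a := by
    intro v a
    simp only [guards, Finset.mem_map, Finset.mem_univ, true_and]
    rfl
  have hdis : ∀ u v, u ≠ v → Disjoint (guards u) (guards v) := by
    intro u v huv
    rw [Finset.disjoint_left]
    intro a hu hv
    obtain ⟨i, rfl⟩ := hmem.1 hu
    obtain ⟨j, hj⟩ := hmem.1 hv
    have := Sum.inl_injective (f.injective hj)
    exact huv (congrArg Sigma.fst this).symm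
  have hk : ∀ e, wE e + ∑ v, wV v < Fintype.card ι := by
    intro e
    have := Finset.single_le_sum (f := wE) (fun _ _ => Nat.zero_le _) (Finset.mem_univ e)
    rw [hcardι]; omega
  obtain ⟨σ, hσ, -, hfree⟩ := (GroupTour.exists_of_connected hG s hk).exists_schedule
    (by rw [hcardι]; omega) (guards := guards) (by simp [guards]) hdis
  refine ⟨_, σ, ?_⟩
  cases var with
  | noReturn => exact hσ
  | withReturn =>
    have := hfree (f (.inr ⟨0, Nat.succ_pos _⟩)) fun v hv => by
      obtain ⟨i, hi⟩ := hmem.1 hv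
      exact Sum.inl_ne_inr (f.injective hi)
    exact ⟨hσ, {f (.inr ⟨0, Nat.succ_pos _⟩)}, by simpa using this.1, fun v => by
      simpa using this.2 v⟩

/-! ### Replacing a strategy by a single group -/

namespace Schedule

variable {V : Type*} [DecidableEq V] {G : SimpleGraph V} {s : V} {k : ℕ}
  {wV : V → ℕ} {wE : Sym2 V → ℕ} {σ : Schedule G s k}

/-- A returning deployment strategy has an agent that guards no vertex, or there is only one
vertex. -/
theorem Valid.exists_forall_notMem_guards (hσ : σ.Valid wV wE) (hr : σ.Returns) :
    (∃ a, ∀ v, a ∉ σ.guards v) ∨ ∀ v, v = s := by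
  refine or_iff_not_imp_left.2 fun hn z => ?_
  push Not at hn
  obtain ⟨M, hMs, hM⟩ := hr
  obtain ⟨a, haM, t, ht, rfl⟩ := hM z
  obtain ⟨v, hv⟩ := hn a
  -- If everybody guards some vertex, a member of `M`, ending at `s`, guards `s`; it is then settled
  -- from time `0` and never sees another vertex.
  have hvs : v = s := by
    rw [← hMs a haM, hσ.guards_stay _ le_rfl v (hσ.all_visited v) a hv]
  subst hvs
  exact hσ.guards_stay t ht v ⟨0, Nat.zero_le _, a, σ.start a⟩ a hv

/-- A deployment strategy can be replaced by one that moves in a single group. -/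
theorem IsDeployment.exists_singleGroup [Fintype V] {var : DeploymentVariant}
    (hσ : σ.IsDeployment wV wE var) :
    ∃ τ : Schedule G s k, τ.IsDeployment wV wE var ∧ τ.SingleGroup := by
  cases var with
  | noReturn =>
    have hval : σ.Valid wV wE := hσ
    obtain ⟨a, -, ha⟩ := hval.groupTour (A := Finset.univ) fun v => by
      obtain ⟨t, ht, a, ha⟩ := hval.all_visited v
      exact ⟨a, Finset.mem_univ a, t, ht, ha⟩
    obtain ⟨τ, hτ, hs, -⟩ := ha.exists_schedule (Fin.pos a) hval.guards_card hval.disjoint_guards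
    exact ⟨τ, hτ, hs⟩
  | withReturn =>
    obtain ⟨hval, hr⟩ := hσ
    obtain ⟨M, hMs, hM⟩ := id hr
    obtain ⟨a, haM, ha⟩ := hval.groupTour hM
    rw [hMs a haM] at ha
    obtain ⟨τ, hτ, hs, hfree⟩ :=
      ha.exists_schedule (Fin.pos a) hval.guards_card hval.disjoint_guards
    refine ⟨τ, ⟨hτ, ?_⟩, hs⟩
    rcases hval.exists_forall_notMem_guards hr with ⟨b, hb⟩ | hsub
    · exact ⟨{b}, by simpa using (hfree b hb).1, fun v => by simpa using (hfree b hb).2 v⟩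
    · exact ⟨Finset.univ, fun b _ => hsub _, fun v =>
        ⟨a, Finset.mem_univ a, 0, Nat.zero_le _, by rw [hsub v, τ.start]⟩⟩

end Schedule

theorem mainTheorem7 {V : Type*} [Fintype V] [DecidableEq V] (G : SimpleGraph V)
    (hG : G.Connected) (s : V) (wV : V → ℕ) (wE : Sym2 V → ℕ) (var : DeploymentVariant) :
    ∃ k : ℕ, IsMinAgents G s wV wE var k ∧
      ∃ σ : Schedule G s k, σ.IsDeployment wV wE var ∧ σ.SingleGroup := by
  have hex := exists_isDeployment hG s wV wE var
  classical
  refine ⟨Nat.find hex, ⟨Nat.find_spec hex, fun m hm => Nat.find_min' hex hm⟩, ?_⟩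
  obtain ⟨σ, hσ⟩ := Nat.find_spec hex
  exact hσ.exists_singleGroup
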